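/- Fix a finite alphabet $\Sigma$. Let $G$ be a context-free grammar over $\Sigma$ in Chomsky normal form (every rule is $v\to zu$ with nonterminals $z,u$, or $v\to a$ with a letter $a$, or $s\to\epsilon$ for the start symbol $s$), with $T$ nonterminals, and let $\mathcal A$ be a safety NFA over $\Sigma$ (every state is accepting) with state set $Q$, $|Q|=n$. For words let $ed(w_1,w_2)$ be the least number of single letter insertions, deletions and substitutions that transform $w_1$ into $w_2$, and for languages let $ed(L_1,L_2)=\sup_{w_1\in L_1}\inf_{w_2\in L_2}ed(w_1,w_2)\in\mathbb N\cup\{\infty\}$. A compact $G$-decomposition of $w\in L(G)$ is a factorization $w=s_1u_1s_2u_2\cdots s_ku_ks_{k+1}$ such that $w(\ell):=s_1u_1^\ell s_2u_2^\ell\cdots s_ku_k^\ell s_{k+1}\in L(G)$ for every $\ell\ge 0$, $|w(0)|=\sum_{i=1}^{k+1}|s_i|\le 2^T$, and $k\le 2^{T+1}-2$. For a word $u$ and $X\subseteq Q$ let $R(u,X)$ be the set of states that can be reached, upon reading some word $ux$ with $x\in\Sigma^*$ arbitrary, from some state in $X$. Consider the following conditions: (i) $ed(L(G),L(\mathcal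 A))=\infty$; (ii) $ed(L(G),L(\mathcal A))>(2^{T+1}-2)\,n+2^T$; (iii) there is a word $w\in L(G)$ with a compact $G$-decomposition $w=s_1u_1\cdots s_ku_ks_{k+1}$ such that $R(u_k,R(u_{k-1},\ldots R(u_1,Q)\ldots))=\emptyset$. Then (i) and (ii) are equivalent, and (iii) implies them. If moreover every state of $\mathcal A$ is reachable from an initial state, then (i), (ii) and (iii) are equivalent. -/

import Mathlib

namespace FED

universe u v

/-- `SingleEdit v w`: the word `w` arises from `v` by one insertion, deletion or substitution of a
letter. -/
inductive SingleEdit {α : Type u} : List α → List α → Prop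
  | insert (x y : List α) (a : α) : SingleEdit (x ++ y) (x ++ a :: y)
  | delete (x y : List α) (a : α) : SingleEdit (x ++ a :: y) (x ++ y)
  | substitute (x y : List α) (a b : α) : SingleEdit (x ++ a :: y) (x ++ b :: y)

/-- `EditsIn m v w`: the word `v` can be transformed into `w` by exactly `m` single letter
operations. -/
inductive EditsIn {α : Type u} : ℕ → List α → List α → Prop
  | refl (w : List α) : EditsIn 0 w w
  | tail {m : ℕ} {v w z : List α} : EditsIn m v w → SingleEdit w z → EditsIn (m + 1) v z

/-- The edit distance between two words: the minimal number of single letter operations that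
transform `v` into `w`. -/
noncomputable def editDist {α : Type u} (v w : List α) : ℕ∞ :=
  ⨅ (m : ℕ) (_ : EditsIn m v w), (m : ℕ∞)

/-- The edit distance from a language to a language: `sup_{v ∈ L₁} inf_{w ∈ L₂} ed(v, w)`. -/
noncomputable def langEditDist {α : Type u} (L₁ L₂ : Language α) : ℕ∞ :=
  ⨆ v ∈ L₁, ⨅ w ∈ L₂, editDist v w

/-- Chomsky normal form: every rule is `v → z u`, or `v → a` with a letter `a`, or
`start → ε`. -/
def IsChomskyNormalForm {α : Type u} (G : ContextFreeGrammar α) : Prop :=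
  ∀ r ∈ G.rules,
    (∃ z y : G.NT, r.output = [Symbol.nonterminal z, Symbol.nonterminal y]) ∨
    (∃ a : α, r.output = [Symbol.terminal a]) ∨
    (r.input = G.initial ∧ r.output = [])

/-- An automaton is safety if every state is accepting. -/
def IsSafety {α : Type u} {σ : Type v} (A : NFA α σ) : Prop :=
  A.accept = Set.univ

/-- Every state can be reached from an initial state. -/
def AllReachable {α : Type u} {σ : Type v} (A : NFA α σ) : Prop :=
  ∀ q : σ, ∃ x : List α, q ∈ A.evalFrom A.start x

/-- `reach A w X` is `R(w, X)`: the states reachable, upon reading any word `x`, from the states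
reachable upon reading `w` from some state of `X`. -/
def reach {α : Type u} {σ : Type v} (A : NFA α σ) (w : List α) (X : Set σ) : Set σ :=
  ⋃ q ∈ X, {p | ∃ x : List α, p ∈ A.evalFrom (A.evalFrom {q} w) x}

/-- The words `s₁, u₁, …, s_k, u_k, s_{k+1}`; `pairs` lists the pairs `(s_i, u_i)` for
`i = 1, …, k`, and `last` is `s_{k+1}`. -/
structure Decomposition (α : Type u) where
  /-- the pairs `(s_i, u_i)` -/
  pairs : List (List α × List α)
  /-- the word `s_{k+1}` -/
  last : List α

/-- The word `s₁ u₁^ℓ s₂ u₂^ℓ ⋯ s_k u_k^ℓ s_{k+1}`. -/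
def Decomposition.pump {α : Type u} (d : Decomposition α) (l : ℕ) : List α :=
  d.pairs.flatMap (fun p => p.1 ++ (List.replicate l p.2).flatten) ++ d.last

/-- `d` is a compact `G`-decomposition of `w`. -/
structure IsCompactDecomposition {α : Type u} (G : ContextFreeGrammar α) [Fintype G.NT]
    (w : List α) (d : Decomposition α) : Prop where
  eq_word : w = d.pairs.flatMap (fun p => p.1 ++ p.2) ++ d.last
  pump_mem : ∀ l : ℕ, d.pump l ∈ G.language
  length_le : (d.pump 0).length ≤ 2 ^ Fintype.card G.NT
  card_le : d.pairs.length ≤ 2 ^ (Fintype.card G.NT + 1) - 2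

/-- `R(u_k, R(u_{k-1}, … R(u_1, Q) … ))`, where `Q` is the set of all states. -/
def Decomposition.nestedReach {α : Type u} {σ : Type v} (A : NFA α σ) (d : Decomposition α) :
    Set σ :=
  d.pairs.foldl (fun X p => reach A p.2 X) Set.univ

/-- Some word of `L(G)` has a compact `G`-decomposition with empty nested reachability set. -/
def HasEmptyNestedReach {α : Type u} {σ : Type v} (G : ContextFreeGrammar α) [Fintype G.NT]
    (A : NFA α σ) : Prop :=
  ∃ w ∈ G.language, ∃ d : Decomposition α,
    IsCompactDecomposition G w d ∧ d.nestedReach A = ∅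

end FED

/-!
If all pumpings `w(ℓ)` of a decomposition lie within bounded edit distance of `L(A)`, choose `ℓ`
larger than the bound: in each block `u_i ^ ℓ` some copy of `u_i` is left unedited, so an accepting
run on the edited word witnesses that the nested reachability set is nonempty. This holds for the
nested set started from any forward closed set containing the initial states. Conversely, if the
nested set started from the reachable states is nonempty, a run can read every `u_i`, and it
suffices to replace each `s_i` by a connecting word shorter than `|Q|` and to delete `s_{k+1}`.

A word of `L(G)` acquires its decomposition by recursion on the set of nonterminals still allowed
in the derivation tree. With root `v`, take an occurrence of `v` with no further `v` below it; the
path between the two is a derivation `v ⇒ x v y`, which gives the pumped words `x` and `y`, and the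
children of the lower occurrence are forests without `v`. When right-hand sides have length at most
`b`, the number of unpumped letters grows by a factor of at most `b` per nonterminal, and the number
of pumped words by a factor of at most `b` plus `2`.
-/

namespace FED

section Edits

variable {α : Type*} {v v' w w' z : List α} {k l m : ℕ}

lemma exists_of_append_eq_append_cons {a b x y : List α} {e : α} (h : a ++ b = x ++ e :: y) :
    (∃ t, x = a ++ t ∧ b = t ++ e :: y) ∨ ∃ t, a = x ++ e :: t ∧ y = t ++ b := by
  rcases List.append_eq_append_iff.1 h with h | ⟨_ | ⟨e', t⟩, rfl, ht⟩
  · exact .inl h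
  · exact .inl ⟨[], by simp, ht.symm⟩
  · obtain ⟨rfl, rfl⟩ := List.cons_eq_cons.1 ht
    exact .inr ⟨t, rfl, rfl⟩

lemma SingleEdit.append_left (h : SingleEdit v w) (z : List α) :
    SingleEdit (z ++ v) (z ++ w) := by
  cases h with
  | insert x y a => simpa using SingleEdit.insert (z ++ x) y a
  | delete x y a => simpa using SingleEdit.delete (z ++ x) y a
  | substitute x y a b => simpa using SingleEdit.substitute (z ++ x) y a b

lemma SingleEdit.append_right (h : SingleEdit v w) (z : List α) :
    SingleEdit (v ++ z) (w ++ z) := by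
  cases h with
  | insert x y a => simpa using SingleEdit.insert x (y ++ z) a
  | delete x y a => simpa using SingleEdit.delete x (y ++ z) a
  | substitute x y a b => simpa using SingleEdit.substitute x (y ++ z) a b

lemma SingleEdit.exists_of_append (h : SingleEdit (v ++ w) z) :
    (∃ v', SingleEdit v v' ∧ z = v' ++ w) ∨ ∃ w', SingleEdit w w' ∧ z = v ++ w' := by
  generalize hvw : v ++ w = s at h
  cases h with
  | insert x y a =>
    rcases List.append_eq_append_iff.1 hvw with ⟨t, rfl, rfl⟩ | ⟨t, rfl, rfl⟩
    · exact .inr ⟨_, .insert t y a, by simp⟩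
    · exact .inl ⟨_, .insert x t a, by simp⟩
  | delete x y a =>
    rcases exists_of_append_eq_append_cons hvw with ⟨t, rfl, rfl⟩ | ⟨t, rfl, rfl⟩
    · exact .inr ⟨_, .delete t y a, by simp⟩
    · exact .inl ⟨_, .delete x t a, by simp⟩
  | substitute x y a b =>
    rcases exists_of_append_eq_append_cons hvw with ⟨t, rfl, rfl⟩ | ⟨t, rfl, rfl⟩
    · exact .inr ⟨_, .substitute t y a b, by simp⟩
    · exact .inl ⟨_, .substitute x t a b, by simp⟩

lemma EditsIn.append_left (h : EditsIn m v w) (z : List α) : EditsIn m (z ++ v) (z ++ w) := by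
  induction h with
  | refl w => exact .refl _
  | tail _ hs ih => exact ih.tail (hs.append_left z)

lemma EditsIn.append_right (h : EditsIn m v w) (z : List α) : EditsIn m (v ++ z) (w ++ z) := by
  induction h with
  | refl w => exact .refl _
  | tail _ hs ih => exact ih.tail (hs.append_right z)

lemma EditsIn.trans (h : EditsIn m v w) (h' : EditsIn k w z) : EditsIn (m + k) v z := by
  induction h' with
  | refl w => exact h
  | tail _ hs ih => exact (ih h).tail hs

lemma EditsIn.append (h : EditsIn m v v') (h' : EditsIn k w w') :
    EditsIn (m + k) (v ++ w) (v' ++ w') :=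
  (h.append_right w).trans (h'.append_left v')

lemma editsIn_nil_right (w : List α) : EditsIn w.length w [] := by
  induction w with
  | nil => exact .refl _
  | cons a w ih =>
    have h : EditsIn 1 [a] [] := (EditsIn.refl _).tail (.delete [] [] a)
    simpa [add_comm] using h.append ih

lemma editsIn_nil_left (w : List α) : EditsIn w.length [] w := by
  induction w with
  | nil => exact .refl _
  | cons a w ih =>
    have h : EditsIn 1 [] [a] := (EditsIn.refl _).tail (.insert [] [] a)
    simpa [add_comm] using h.append ih

lemma editsIn_length_add_length (v w : List α) : EditsIn (v.length + w.length) v w :=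
  (editsIn_nil_right v).trans (editsIn_nil_left w)

lemma EditsIn.eq_of_zero (h : EditsIn 0 v w) : v = w := by
  cases h
  rfl

lemma EditsIn.exists_of_append (h : EditsIn m (v ++ w) z) :
    ∃ v' w' i j, z = v' ++ w' ∧ EditsIn i v v' ∧ EditsIn j w w' ∧ i + j = m := by
  generalize hvw : v ++ w = s at h
  induction h with
  | refl => exact ⟨v, w, 0, 0, hvw.symm, .refl _, .refl _, rfl⟩
  | tail _ hs ih =>
    obtain ⟨v', w', i, j, rfl, hv, hw, rfl⟩ := ih hvw
    rcases hs.exists_of_append with ⟨v'', hv', rfl⟩ | ⟨w'', hw', rfl⟩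
    · exact ⟨v'', w', i + 1, j, rfl, hv.tail hv', hw, Nat.add_right_comm i 1 j⟩
    · exact ⟨v', w'', i, j + 1, rfl, hv, hw.tail hw', rfl⟩

lemma EditsIn.isInfix_of_flatten_replicate (hm : m < l)
    (h : EditsIn m (List.replicate l v).flatten w) : v <:+: w := by
  induction l generalizing m w with
  | zero => exact absurd hm m.not_lt_zero
  | succ l ih =>
    rw [List.replicate_succ, List.flatten_cons] at h
    obtain ⟨x, y, i, j, rfl, hx, hy, rfl⟩ := h.exists_of_append
    cases i with
    | zero => exact hx.eq_of_zero ▸ List.infix_append' [] v y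
    | succ i => exact (ih (by omega) hy).trans (List.suffix_append x y).isInfix

lemma editDist_lt_iff : editDist v w < m ↔ ∃ k < m, EditsIn k v w := by
  simp only [editDist, iInf_lt_iff, Nat.cast_lt, exists_prop, and_comm]

lemma exists_editsIn_of_langEditDist_lt {L₁ L₂ : Language α} (h : langEditDist L₁ L₂ < l)
    (hv : v ∈ L₁) : ∃ w ∈ L₂, ∃ m < l, EditsIn m v w := by
  have hlt : ⨅ w ∈ L₂, editDist v w < l :=
    (le_iSup₂ (f := fun v (_ : v ∈ L₁) => ⨅ w ∈ L₂, editDist v w) v hv).trans_lt h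
  simpa only [iInf_lt_iff, editDist_lt_iff, exists_prop] using hlt

lemma langEditDist_le_of_forall_exists_editsIn {L₁ L₂ : Language α}
    (h : ∀ v ∈ L₁, ∃ w ∈ L₂, ∃ m ≤ l, EditsIn m v w) : langEditDist L₁ L₂ ≤ l := by
  refine iSup₂_le fun v hv => ?_
  obtain ⟨w, hw, m, hm, he⟩ := h v hv
  calc ⨅ w ∈ L₂, editDist v w ≤ editDist v w := iInf₂_le w hw
    _ ≤ m := iInf₂_le m he
    _ ≤ l := Nat.cast_le.2 hm

end Edits

namespace Decomposition

variable {α : Type*}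

/-- The concatenation of two decompositions. The unpumped word at the end of `d` is merged with
the one at the beginning of `e`, so that the numbers of pumped words add up. -/
def append (d e : Decomposition α) : Decomposition α :=
  match e.pairs with
  | [] => ⟨d.pairs, d.last ++ e.last⟩
  | (s, u) :: ps => ⟨d.pairs ++ (d.last ++ s, u) :: ps, e.last⟩

lemma pump_append (d e : Decomposition α) (l : ℕ) :
    (d.append e).pump l = d.pump l ++ e.pump l := by
  rcases e with ⟨_ | ⟨⟨s, u⟩, ps⟩, t⟩ <;> simp [append, pump]

lemma length_pairs_append (d e : Decomposition α) :
    (d.append e).pairs.length = d.pairs.length + e.pairs.length := by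
  rcases e with ⟨_ | ⟨⟨s, u⟩, ps⟩, t⟩ <;> simp [append]

/-- The decomposition `s₁ = s` of the word `s`, with nothing to pump. -/
def ofWord (s : List α) : Decomposition α := ⟨[], s⟩

/-- The decomposition `s₁ u₁ s₂` of the word `u` in which `u₁ = u` and `s₁`, `s₂` are empty. -/
def ofPower (u : List α) : Decomposition α := ⟨[([], u)], []⟩

lemma pump_ofPower (u : List α) (l : ℕ) : (ofPower u).pump l = (List.replicate l u).flatten := by
  simp [ofPower, pump]

lemma pump_cons (s u : List α) (ps : List (List α × List α)) (t : List α) (l : ℕ) :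
    pump ⟨(s, u) :: ps, t⟩ l = s ++ ((List.replicate l u).flatten ++ pump ⟨ps, t⟩ l) := by
  simp [pump]

lemma pump_one (d : Decomposition α) :
    d.pump 1 = d.pairs.flatMap (fun p => p.1 ++ p.2) ++ d.last := by
  simp [pump]

end Decomposition

section Automata

variable {α σ : Type*} {A : NFA α σ} {S X Y : Set σ} {w x : List α} {q : σ}

lemma evalFrom_mono (h : X ⊆ Y) (w : List α) : A.evalFrom X w ⊆ A.evalFrom Y w := by
  rw [← Set.union_eq_self_of_subset_left h, NFA.evalFrom_union]
  exact Set.subset_union_left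

/-- The states reachable from `X` by reading an arbitrary word. -/
def forwardClosure (A : NFA α σ) (X : Set σ) : Set σ := ⋃ x : List α, A.evalFrom X x

lemma evalFrom_subset_forwardClosure (x : List α) : A.evalFrom X x ⊆ forwardClosure A X :=
  Set.subset_iUnion (fun x => A.evalFrom X x) x

lemma reach_eq_forwardClosure (A : NFA α σ) (u : List α) (X : Set σ) :
    reach A u X = forwardClosure A (A.evalFrom X u) := by
  ext p
  simp only [reach, forwardClosure, Set.mem_iUnion, Set.mem_ofPred_eq, ← NFA.evalFrom_append,
    exists_prop, NFA.mem_evalFrom_iff_exists (S := X)]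
  exact ⟨fun ⟨q, hq, x, hx⟩ => ⟨x, q, hq, hx⟩, fun ⟨x, q, hq, hx⟩ => ⟨q, hq, x, hx⟩⟩

lemma forwardClosure_start_eq_univ (h : AllReachable A) : forwardClosure A A.start = Set.univ :=
  Set.eq_univ_of_forall fun q => Set.mem_iUnion.2 (h q)

/-- No transition leaves `X`. -/
def IsForwardClosed (A : NFA α σ) (X : Set σ) : Prop := ∀ x : List α, A.evalFrom X x ⊆ X

lemma isForwardClosed_univ (A : NFA α σ) : IsForwardClosed A Set.univ :=
  fun _ => Set.subset_univ _

lemma isForwardClosed_forwardClosure (A : NFA α σ) (X : Set σ) :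
    IsForwardClosed A (forwardClosure A X) := by
  intro y
  rw [forwardClosure, NFA.evalFrom_iUnion]
  refine Set.iUnion_subset fun x => ?_
  rw [← NFA.evalFrom_append]
  exact evalFrom_subset_forwardClosure (x ++ y)

lemma IsForwardClosed.evalFrom_subset_reach (hX : IsForwardClosed A X) (x u y : List α) :
    A.evalFrom X (x ++ u ++ y) ⊆ reach A u X := by
  rw [reach_eq_forwardClosure, NFA.evalFrom_append, NFA.evalFrom_append]
  exact (evalFrom_mono (evalFrom_mono (hX x) u) y).trans (evalFrom_subset_forwardClosure y)

lemma exists_length_lt_of_card_le [Fintype σ] (hq : q ∈ A.evalFrom S x)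
    (hx : Fintype.card σ ≤ x.length) : ∃ y : List α, y.length < x.length ∧ q ∈ A.evalFrom S y := by
  have exists_state (i : Fin (x.length + 1)) :
      ∃ r ∈ A.evalFrom S (x.take i), q ∈ A.evalFrom {r} (x.drop i) := by
    rwa [← NFA.mem_evalFrom_iff_exists, ← NFA.evalFrom_append, List.take_append_drop]
  choose state mem_state mem_evalFrom_state using exists_state
  obtain ⟨i, j, hij, hstate⟩ : ∃ i j, i < j ∧ state i = state j := by
    obtain ⟨i, j, hne, h⟩ := Fintype.exists_ne_map_eq_of_card_lt state (by simpa using by omega)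
    exact hne.lt_or_gt.elim (⟨i, j, ·, h⟩) (⟨j, i, ·, h.symm⟩)
  refine ⟨x.take i ++ x.drop j, ?_, ?_⟩
  · rw [List.length_append, List.length_take, List.length_drop]
    omega
  · rw [NFA.evalFrom_append, NFA.mem_evalFrom_iff_exists]
    exact ⟨state i, mem_state i, hstate ▸ mem_evalFrom_state j⟩

lemma exists_length_lt_card [Fintype σ] (hq : q ∈ forwardClosure A S) :
    ∃ y : List α, y.length < Fintype.card σ ∧ q ∈ A.evalFrom S y := by
  obtain ⟨y, hy, hmin⟩ := (measure List.length).wf.has_min _ (Set.mem_iUnion.1 hq)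
  refine ⟨y, not_le.1 fun hle => ?_, hy⟩
  obtain ⟨z, hlt, hz⟩ := exists_length_lt_of_card_le hy hle
  exact hmin z hz hlt

lemma mem_accepts_iff_evalFrom_nonempty (hA : IsSafety A) :
    w ∈ A.accepts ↔ (A.evalFrom A.start w).Nonempty := by
  rw [IsSafety] at hA
  simp only [NFA.mem_accepts, hA, Set.mem_univ, true_and, Set.Nonempty]

end Automata

section NestedReach

variable {α σ : Type*} {A : NFA α σ}

/-- The nested reachability set `R(u_k, … R(u_1, X) … )` started from `X` instead of from the set
of all states. -/
def Decomposition.nestedReachFrom (A : NFA α σ) (d : Decomposition α) (X : Set σ) : Set σ :=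
  d.pairs.foldl (fun X p => reach A p.2 X) X

lemma nestedReachFrom_nonempty_of_editsIn {d : Decomposition α} {l m : ℕ} (hm : m < l)
    {w : List α} (he : EditsIn m (d.pump l) w) {X : Set σ} (hX : IsForwardClosed A X)
    (hw : (A.evalFrom X w).Nonempty) : (d.nestedReachFrom A X).Nonempty := by
  obtain ⟨ps, t⟩ := d
  induction ps generalizing m w X with
  | nil => exact hw.mono (hX w)
  | cons p ps ih =>
    obtain ⟨s, u⟩ := p
    rw [Decomposition.pump_cons] at he
    obtain ⟨s', _, i, _, rfl, -, htail, rfl⟩ := he.exists_of_append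
    obtain ⟨u', w', j, k, rfl, hu, hrest, rfl⟩ := htail.exists_of_append
    obtain ⟨x, y, rfl⟩ := hu.isInfix_of_flatten_replicate (by omega)
    have hsub : A.evalFrom X (s' ++ (x ++ u ++ y)) ⊆ reach A u X := by
      simpa only [List.append_assoc] using hX.evalFrom_subset_reach (s' ++ x) u y
    refine ih (X := reach A u X) (by omega) ?_ ?_ hrest
    · exact reach_eq_forwardClosure A u X ▸ isForwardClosed_forwardClosure A _
    · rw [← List.append_assoc, NFA.evalFrom_append] at hw
      exact hw.mono (evalFrom_mono hsub w')

lemma nestedReachFrom_nonempty_of_langEditDist_ne_top {L : Language α}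
    (h : langEditDist L A.accepts ≠ ⊤) {d : Decomposition α} (hd : ∀ l, d.pump l ∈ L)
    {X : Set σ} (hX : IsForwardClosed A X) (hstart : A.start ⊆ X) :
    (d.nestedReachFrom A X).Nonempty := by
  obtain ⟨l, hl⟩ := ENat.exists_nat_gt h
  obtain ⟨w, hw, m, hm, he⟩ := exists_editsIn_of_langEditDist_lt hl (hd l)
  obtain ⟨p, -, hp⟩ := NFA.mem_accepts.1 hw
  exact nestedReachFrom_nonempty_of_editsIn hm he hX ⟨p, evalFrom_mono hstart w hp⟩

variable [Fintype σ]

lemma exists_editsIn_of_nestedReachFrom_nonempty {d : Decomposition α} {S : Set σ}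
    (h : (d.nestedReachFrom A (forwardClosure A S)).Nonempty) :
    ∃ w, (A.evalFrom S w).Nonempty ∧
      ∃ m ≤ d.pairs.length * Fintype.card σ + (d.pump 0).length, EditsIn m (d.pump 1) w := by
  obtain ⟨ps, t⟩ := d
  induction ps generalizing S with
  | nil =>
    obtain ⟨q, hq⟩ := h
    obtain ⟨x, hx⟩ := Set.mem_iUnion.1 hq
    obtain ⟨r, hr, -⟩ := NFA.mem_evalFrom_iff_exists.1 hx
    exact ⟨[], ⟨r, hr⟩, t.length, Nat.le_add_left _ _, editsIn_nil_right t⟩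
  | cons p ps ih =>
    obtain ⟨s, u⟩ := p
    obtain ⟨w, ⟨r, hr⟩, m, hm, he⟩ := ih (S := A.evalFrom (forwardClosure A S) u)
      (reach_eq_forwardClosure A u _ ▸ h)
    rw [← NFA.evalFrom_append] at hr
    obtain ⟨q, hq, hr⟩ := NFA.mem_evalFrom_iff_exists.1 hr
    obtain ⟨y, hy, hqy⟩ := exists_length_lt_card hq
    refine ⟨y ++ (u ++ w), ⟨r, ?_⟩, s.length + y.length + m, ?_, ?_⟩
    · rw [NFA.evalFrom_append]
      exact NFA.mem_evalFrom_iff_exists.2 ⟨q, hqy, hr⟩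
    · simp only [Decomposition.pump_cons, List.replicate_zero, List.flatten_nil, List.nil_append,
        List.length_append, List.length_cons, Nat.succ_mul] at hm ⊢
      omega
    · simpa [Decomposition.pump_cons] using
        (editsIn_length_add_length s y).append (he.append_left u)

lemma langEditDist_accepts_le (hA : IsSafety A) {L : Language α} {k c : ℕ}
    (h : ∀ w ∈ L, ∃ d : Decomposition α, d.pump 1 = w ∧ d.pairs.length ≤ k ∧
      (d.pump 0).length ≤ c ∧ (d.nestedReachFrom A (forwardClosure A A.start)).Nonempty) :
    langEditDist L A.accepts ≤ (k * Fintype.card σ + c : ℕ) := by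
  refine langEditDist_le_of_forall_exists_editsIn fun w hw => ?_
  obtain ⟨d, rfl, hk, hc, hd⟩ := h w hw
  obtain ⟨w', hw', m, hm, he⟩ := exists_editsIn_of_nestedReachFrom_nonempty hd
  exact ⟨w', (mem_accepts_iff_evalFrom_nonempty hA).2 hw', m, hm.trans (by gcongr), he⟩

end NestedReach

section Grammars

variable {α : Type*} {G : ContextFreeGrammar α} {P : Finset G.NT} {v : G.NT}
  {o u u' : List (Symbol α G.NT)} {w w' x y : List α}

lemma derives_output (h : ⟨v, o⟩ ∈ G.rules) : G.Derives [Symbol.nonterminal v] o :=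
  ContextFreeGrammar.Produces.single
    ⟨_, h, ContextFreeRule.Rewrites.input_output (r := ⟨v, o⟩)⟩

lemma derives_append {s s' t t' : List (Symbol α G.NT)} (h : G.Derives s s')
    (h' : G.Derives t t') : G.Derives (s ++ t) (s' ++ t') :=
  (h.append_right t).trans (h'.append_left s')

lemma derives_replicate
    (h : G.Derives [Symbol.nonterminal v]
      (x.map Symbol.terminal ++ [Symbol.nonterminal v] ++ y.map Symbol.terminal)) (l : ℕ) :
    G.Derives [Symbol.nonterminal v]
      ((List.replicate l x).flatten.map Symbol.terminal ++ [Symbol.nonterminal v] ++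
        (List.replicate l y).flatten.map Symbol.terminal) := by
  induction l with
  | zero => exact .refl _
  | succ l ih =>
    rw [List.replicate_succ' (a := x), List.replicate_succ (a := y)]
    simpa using ih.trans ((h.append_left _).append_right _)

/-- `ForestYield G P u w`: the word `w` is the yield of a derivation forest whose sequence of roots
is the sentential form `u` and whose inner nodes are labelled by nonterminals in `P`. -/
inductive ForestYield (G : ContextFreeGrammar α) (P : Finset G.NT) :
    List (Symbol α G.NT) → List α → Prop
  | nil : ForestYield G P [] []
  | terminal {u : List (Symbol α G.NT)} {w : List α} (a : α) (h : ForestYield G P u w) :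
      ForestYield G P (Symbol.terminal a :: u) (a :: w)
  | nonterminal {v : G.NT} {o u : List (Symbol α G.NT)} {w₁ w₂ : List α} (hv : v ∈ P)
      (hr : ⟨v, o⟩ ∈ G.rules) (h₁ : ForestYield G P o w₁) (h₂ : ForestYield G P u w₂) :
      ForestYield G P (Symbol.nonterminal v :: u) (w₁ ++ w₂)

namespace ForestYield

lemma map_terminal (P : Finset G.NT) (w : List α) : ForestYield G P (w.map Symbol.terminal) w := by
  induction w with
  | nil => exact .nil
  | cons a w ih => exact .terminal a ih

lemma append (h : ForestYield G P u w) (h' : ForestYield G P u' w') :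
    ForestYield G P (u ++ u') (w ++ w') := by
  induction h with
  | nil => exact h'
  | terminal a _ ih => exact .terminal a ih
  | nonterminal hv hr h₁ _ _ ih => simpa using ForestYield.nonterminal hv hr h₁ ih

lemma exists_of_append (h : ForestYield G P (u ++ u') w) :
    ∃ w₁ w₂, w = w₁ ++ w₂ ∧ ForestYield G P u w₁ ∧ ForestYield G P u' w₂ := by
  induction u generalizing w with
  | nil => exact ⟨[], w, rfl, .nil, h⟩
  | cons _ u ih =>
    cases h with
    | terminal a h =>
      obtain ⟨w₁, w₂, rfl, h₁, h₂⟩ := ih h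
      exact ⟨a :: w₁, w₂, rfl, .terminal a h₁, h₂⟩
    | @nonterminal _ _ _ c _ hv hr hc h =>
      obtain ⟨w₁, w₂, rfl, h₁, h₂⟩ := ih h
      exact ⟨c ++ w₁, w₂, by simp, .nonterminal hv hr hc h₁, h₂⟩

lemma derives (h : ForestYield G P u w) : G.Derives u (w.map Symbol.terminal) := by
  induction h with
  | nil => exact .refl _
  | terminal a _ ih => exact ih.append_left [Symbol.terminal a]
  | nonterminal _ hr _ _ ih₁ ih₂ =>
    simpa using derives_append ((derives_output hr).trans ih₁) ih₂

lemma of_derives (hP : ∀ v, v ∈ P) (h : G.Derives u (w.map Symbol.terminal)) :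
    ForestYield G P u w := by
  induction h using Relation.ReflTransGen.head_induction_on with
  | refl => exact map_terminal P w
  | head hp _ ih =>
    obtain ⟨r, hr, hrw⟩ := hp
    obtain ⟨p, q, rfl, rfl⟩ := hrw.exists_parts
    obtain ⟨_, w₃, rfl, h', h₃⟩ := ih.exists_of_append
    obtain ⟨w₁, w₂, rfl, h₁, h₂⟩ := h'.exists_of_append
    have htree : ForestYield G P [Symbol.nonterminal r.input] w₂ := by
      simpa using ForestYield.nonterminal (hP r.input) hr h₂ .nil
    exact (h₁.append htree).append h₃

variable [DecidableEq G.NT]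

lemma erase_or_exists_lowest (h : ForestYield G P u w) (v : G.NT) :
    ForestYield G (P.erase v) u w ∨
      ∃ (x c y : List α) (o : List (Symbol α G.NT)), w = x ++ c ++ y ∧
        ⟨v, o⟩ ∈ G.rules ∧ ForestYield G (P.erase v) o c ∧
        G.Derives u (x.map Symbol.terminal ++ [Symbol.nonterminal v] ++ y.map Symbol.terminal) := by
  induction h with
  | nil => exact .inl .nil
  | terminal a _ ih =>
    rcases ih with ih | ⟨x, c, y, o, rfl, ho, hc, hd⟩
    · exact .inl (.terminal a ih)
    · exact .inr ⟨a :: x, c, y, o, rfl, ho, hc, hd.append_left [Symbol.terminal a]⟩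
  | @nonterminal z _ u w₁ w₂ hz hr h₁ h₂ ih₁ ih₂ =>
    rcases ih₁ with ih₁ | ⟨x, c, y, o, rfl, ho, hc, hd⟩
    · by_cases hzv : z = v
      · subst hzv
        exact .inr ⟨[], w₁, w₂, _, rfl, hr, ih₁, h₂.derives.append_left [Symbol.nonterminal z]⟩
      rcases ih₂ with ih₂ | ⟨x, c, y, o, rfl, ho, hc, hd⟩
      · exact .inl (.nonterminal (Finset.mem_erase.2 ⟨hzv, hz⟩) hr ih₁ ih₂)
      · refine .inr ⟨w₁ ++ x, c, y, o, by simp, ho, hc, ?_⟩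
        simpa using derives_append ((derives_output hr).trans h₁.derives) hd
    · refine .inr ⟨x, c, y ++ w₂, o, by simp, ho, hc, ?_⟩
      simpa using derives_append ((derives_output hr).trans hd) h₂.derives

lemma exists_lowest (h : ForestYield G P [Symbol.nonterminal v] w) :
    ∃ (x c y : List α) (o : List (Symbol α G.NT)), w = x ++ c ++ y ∧
      ⟨v, o⟩ ∈ G.rules ∧ ForestYield G (P.erase v) o c ∧ G.Derives [Symbol.nonterminal v]
        (x.map Symbol.terminal ++ [Symbol.nonterminal v] ++ y.map Symbol.terminal) := by
  refine (h.erase_or_exists_lowest v).resolve_left fun h' => ?_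
  cases h' with
  | nonterminal hv => exact Finset.notMem_erase v P hv

end ForestYield

/-- `Pumpable G u w m k`: the word `w` has a decomposition with at most `k` pumped words and at
most `m` other letters, all of whose pumpings are derivable from the sentential form `u`. -/
def Pumpable (G : ContextFreeGrammar α) (u : List (Symbol α G.NT)) (w : List α) (m k : ℕ) : Prop :=
  ∃ d : Decomposition α, d.pump 1 = w ∧ (∀ l, G.Derives u ((d.pump l).map Symbol.terminal)) ∧
    (d.pump 0).length ≤ m ∧ d.pairs.length ≤ k

namespace Pumpable

variable {m m' k k' : ℕ}

lemma mono (h : Pumpable G u w m k) (hm : m ≤ m') (hk : k ≤ k') : Pumpable G u w m' k' := by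
  obtain ⟨d, hw, hd, hdm, hdk⟩ := h
  exact ⟨d, hw, hd, hdm.trans hm, hdk.trans hk⟩

lemma append (h : Pumpable G u w m k) (h' : Pumpable G u' w' m' k') :
    Pumpable G (u ++ u') (w ++ w') (m + m') (k + k') := by
  obtain ⟨d, rfl, hd, hm, hk⟩ := h
  obtain ⟨e, rfl, he, hm', hk'⟩ := h'
  refine ⟨d.append e, d.pump_append e 1, fun l => ?_, ?_, ?_⟩
  · simpa only [d.pump_append e, List.map_append] using derives_append (hd l) (he l)
  · simpa only [d.pump_append e, List.length_append] using add_le_add hm hm'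
  · simpa only [d.length_pairs_append e] using add_le_add hk hk'

lemma map_terminal (w : List α) : Pumpable G (w.map Symbol.terminal) w w.length 0 :=
  ⟨.ofWord w, rfl, fun _ => .refl _, le_rfl, le_rfl⟩

lemma of_recursion
    (h : G.Derives [Symbol.nonterminal v]
      (x.map Symbol.terminal ++ [Symbol.nonterminal v] ++ y.map Symbol.terminal))
    (ho : ⟨v, o⟩ ∈ G.rules) (hw : Pumpable G o w m k) :
    Pumpable G [Symbol.nonterminal v] (x ++ w ++ y) m (k + 2) := by
  obtain ⟨d, rfl, hd, hm, hk⟩ := hw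
  let e := ((Decomposition.ofPower x).append d).append (.ofPower y)
  have pump_e (l : ℕ) :
      e.pump l = (List.replicate l x).flatten ++ d.pump l ++ (List.replicate l y).flatten := by
    simp only [e, Decomposition.pump_append, Decomposition.pump_ofPower]
  refine ⟨e, by simp [pump_e], fun l => ?_, by simpa [pump_e] using hm, ?_⟩
  · rw [pump_e, List.map_append, List.map_append]
    exact (derives_replicate h l).trans
      ((((derives_output ho).trans (hd l)).append_left _).append_right _)
  · simp only [e, Decomposition.length_pairs_append, Decomposition.ofPower, List.length_singleton]
    omega

end Pumpable

open Finset in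
lemma ForestYield.pumpable {b : ℕ} (hb : 0 < b)
    (hG : ∀ r ∈ G.rules, r.output.length ≤ b) (h : ForestYield G P u w) :
    Pumpable G u w (u.length * b ^ #P) (u.length * (2 * ∑ i ∈ range #P, b ^ i)) := by
  classical
  induction P using Finset.strongInduction generalizing u w with
  | H P ih_ssubset =>
  have tree {v : G.NT} {w : List α} (hv : v ∈ P) (h : ForestYield G P [Symbol.nonterminal v] w) :
      Pumpable G [Symbol.nonterminal v] w (b ^ #P) (2 * ∑ i ∈ range #P, b ^ i) := by
    obtain ⟨x, c, y, o, rfl, ho, hc, hd⟩ := h.exists_lowest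
    refine (Pumpable.of_recursion hd ho (ih_ssubset _ (erase_ssubset hv) hc)).mono ?_ ?_
    · rw [← card_erase_add_one hv, pow_succ']
      gcongr
      exact hG _ ho
    · rw [← card_erase_add_one hv, geom_sum_succ, mul_add, mul_left_comm, mul_one]
      gcongr
      exact hG _ ho
  induction h with
  | nil => simpa using Pumpable.map_terminal (G := G) []
  | terminal a _ ih =>
    refine ((Pumpable.map_terminal [a]).append ih).mono ?_ ?_
    · rw [List.length_singleton, List.length_cons, Nat.succ_mul, add_comm]
      gcongr
      exact Nat.one_le_pow _ _ hb
    · rw [zero_add, List.length_cons]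
      gcongr
      exact Nat.le_succ _
  | @nonterminal v _ _ w₁ _ hv hr h₁ _ _ ih =>
    have hroot : ForestYield G P [Symbol.nonterminal v] w₁ := by
      simpa using h₁.nonterminal hv hr .nil
    exact ((tree hv hroot).append ih).mono (by rw [List.length_cons, add_one_mul, add_comm])
      (by rw [List.length_cons, add_one_mul, add_comm])

lemma two_mul_geomSum_two (n : ℕ) : 2 * ∑ i ∈ Finset.range n, 2 ^ i = 2 ^ (n + 1) - 2 := by
  rw [Nat.geomSum_eq le_rfl]
  omega

lemma exists_isCompactDecomposition [Fintype G.NT] (hG : ∀ r ∈ G.rules, r.output.length ≤ 2)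
    (hw : w ∈ G.language) : ∃ d, IsCompactDecomposition G w d := by
  have hforest : ForestYield G Finset.univ [Symbol.nonterminal G.initial] w :=
    .of_derives Finset.mem_univ hw
  obtain ⟨d, rfl, hpump, hlen, hcard⟩ := hforest.pumpable two_pos hG
  rw [List.length_singleton, one_mul, Finset.card_univ] at hlen hcard
  exact ⟨d, d.pump_one, hpump, hlen, hcard.trans_eq (two_mul_geomSum_two _)⟩

lemma IsChomskyNormalForm.length_output_le_two (hG : IsChomskyNormalForm G)
    {r : ContextFreeRule α G.NT} (hr : r ∈ G.rules) : r.output.length ≤ 2 := by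
  rcases hG r hr with ⟨z, y, h⟩ | ⟨a, h⟩ | ⟨-, h⟩ <;> simp [h]

end Grammars

section Comparison

variable {α σ : Type*} {G : ContextFreeGrammar α} [Fintype G.NT] {A : NFA α σ}

lemma HasEmptyNestedReach.langEditDist_eq_top (h : HasEmptyNestedReach G A) :
    langEditDist G.language A.accepts = ⊤ := by
  obtain ⟨w, -, d, hd, hempty⟩ := h
  by_contra hfinite
  exact (nestedReachFrom_nonempty_of_langEditDist_ne_top hfinite hd.pump_mem
    (isForwardClosed_univ A) (Set.subset_univ _)).ne_empty hempty

variable [Fintype σ]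

lemma langEditDist_le_of_nestedReachFrom_nonempty
    (hG : ∀ r ∈ G.rules, r.output.length ≤ 2) (hA : IsSafety A)
    (h : ∀ w ∈ G.language, ∀ d, IsCompactDecomposition G w d →
      (d.nestedReachFrom A (forwardClosure A A.start)).Nonempty) :
    langEditDist G.language A.accepts ≤
      ((2 ^ (Fintype.card G.NT + 1) - 2) * Fintype.card σ + 2 ^ Fintype.card G.NT : ℕ) := by
  refine langEditDist_accepts_le hA fun w hw => ?_
  obtain ⟨d, hd⟩ := exists_isCompactDecomposition hG hw
  exact ⟨d, d.pump_one.trans hd.eq_word.symm, hd.card_le, hd.length_le, h w hw d hd⟩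

lemma langEditDist_eq_top_of_lt (hG : ∀ r ∈ G.rules, r.output.length ≤ 2) (hA : IsSafety A)
    (h : (((2 ^ (Fintype.card G.NT + 1) - 2) * Fintype.card σ + 2 ^ Fintype.card G.NT : ℕ) : ℕ∞) <
      langEditDist G.language A.accepts) :
    langEditDist G.language A.accepts = ⊤ := by
  by_contra hfinite
  refine h.not_ge (langEditDist_le_of_nestedReachFrom_nonempty hG hA fun w _ d hd => ?_)
  exact nestedReachFrom_nonempty_of_langEditDist_ne_top hfinite hd.pump_mem
    (isForwardClosed_forwardClosure A A.start) (evalFrom_subset_forwardClosure [])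

lemma hasEmptyNestedReach_of_lt (hG : ∀ r ∈ G.rules, r.output.length ≤ 2) (hA : IsSafety A)
    (hreach : AllReachable A)
    (h : (((2 ^ (Fintype.card G.NT + 1) - 2) * Fintype.card σ + 2 ^ Fintype.card G.NT : ℕ) : ℕ∞) <
      langEditDist G.language A.accepts) :
    HasEmptyNestedReach G A := by
  by_contra hne
  refine h.not_ge (langEditDist_le_of_nestedReachFrom_nonempty hG hA fun w hw d hd => ?_)
  rw [forwardClosure_start_eq_univ hreach]
  exact Set.nonempty_iff_ne_empty.2 fun hempty => hne ⟨w, hw, d, hd, hempty⟩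

end Comparison

end FED

theorem lemmal_general {α : Type*} {σ : Type*} [Fintype σ]
    (G : ContextFreeGrammar α) [Fintype G.NT] (hG : ∀ r ∈ G.rules, r.output.length ≤ 2)
    (A : NFA α σ) (hA : FED.IsSafety A) :
    (FED.langEditDist G.language A.accepts = ⊤ ↔
      (((2 ^ (Fintype.card G.NT + 1) - 2) * Fintype.card σ + 2 ^ Fintype.card G.NT : ℕ) : ℕ∞) <
        FED.langEditDist G.language A.accepts) ∧
    (FED.HasEmptyNestedReach G A → FED.langEditDist G.language A.accepts = ⊤) ∧
    (FED.AllReachable A →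
      List.TFAE
        [FED.langEditDist G.language A.accepts = ⊤,
          (((2 ^ (Fintype.card G.NT + 1) - 2) * Fintype.card σ + 2 ^ Fintype.card G.NT : ℕ) : ℕ∞) <
            FED.langEditDist G.language A.accepts,
          FED.HasEmptyNestedReach G A]) := by
  have lt_of_top (h : FED.langEditDist G.language A.accepts = ⊤) :
      (((2 ^ (Fintype.card G.NT + 1) - 2) * Fintype.card σ + 2 ^ Fintype.card G.NT : ℕ) : ℕ∞) <
        FED.langEditDist G.language A.accepts :=
    h ▸ ENat.natCast_lt_top _
  have top_of_lt := FED.langEditDist_eq_top_of_lt hG hA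
  refine ⟨⟨lt_of_top, top_of_lt⟩, FED.HasEmptyNestedReach.langEditDist_eq_top, fun hreach => ?_⟩
  tfae_have 1 ↔ 2 := ⟨lt_of_top, top_of_lt⟩
  tfae_have 3 → 1 := FED.HasEmptyNestedReach.langEditDist_eq_top
  tfae_have 2 → 3 := FED.hasEmptyNestedReach_of_lt hG hA hreach
  tfae_finish

theorem lemmal {α : Type*} {σ : Type*} [Fintype σ]
    (G : ContextFreeGrammar α) [Fintype G.NT] (hG : FED.IsChomskyNormalForm G)
    (A : NFA α σ) (hA : FED.IsSafety A) :
    (FED.langEditDist G.language A.accepts = ⊤ ↔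
      (((2 ^ (Fintype.card G.NT + 1) - 2) * Fintype.card σ + 2 ^ Fintype.card G.NT : ℕ) : ℕ∞) <
        FED.langEditDist G.language A.accepts) ∧
    (FED.HasEmptyNestedReach G A → FED.langEditDist G.language A.accepts = ⊤) ∧
    (FED.AllReachable A →
      List.TFAE
        [FED.langEditDist G.language A.accepts = ⊤,
          (((2 ^ (Fintype.card G.NT + 1) - 2) * Fintype.card σ + 2 ^ Fintype.card G.NT : ℕ) : ℕ∞) <
            FED.langEditDist G.language A.accepts,
          FED.HasEmptyNestedReach G A]) :=
  lemmal_general G (fun _ hr => hG.length_output_le_two hr) A hA
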